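/- Let $E$ and $F$ be Banach spaces over the same scalar field $\mathbb{K}\in\{\mathbb{R},\mathbb{C}\}$. A bounded linear operator between Banach spaces is called weakly compact if it maps the closed unit ball to a relatively weakly compact set, and completely continuous if it maps weakly convergent sequences to norm convergent sequences. Suppose that $E$ has the Dunford--Pettis property, i.e. for every Banach space $G$ every weakly compact operator $E\to G$ is completely continuous, and suppose that every bounded linear operator $E\to F$ is weakly compact. Let $k\in\mathbb{N}$, let $A\colon E^k\to F$ be a continuous $k$-linear map, and let $(x_1^n)_n,\dots,(x_k^n)_n$ be weak Cauchy sequences in $E$ (that is, $(\varphi(x_i^n))_n$ is a Cauchy sequence of scalars for every $\varphi\in E^*$ and every $i$). Then the sequence $\bigl(A(x_1^n,\dots,x_k^n)\bigr)_n$ is norm convergent in $F$. -/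

import Mathlib

open Filter Topology

universe w u v

/-- A bounded operator `T : E → F` is *weakly compact* if the image of the closed unit ball of `E`
is relatively compact in the weak topology of `F`. -/
def IsWeaklyCompactOperator {𝕜 E F : Type*} [RCLike 𝕜] [NormedAddCommGroup E] [NormedSpace 𝕜 E]
    [NormedAddCommGroup F] [NormedSpace 𝕜 F] (T : E →L[𝕜] F) : Prop :=
  IsCompact (closure (toWeakSpace 𝕜 F '' (T '' Metric.closedBall (0 : E) 1)))

/-- The sequence `x` converges to `a` in the weak topology of `E`. -/
def WeaklyConvergesTo (𝕜 : Type*) {E : Type*} [RCLike 𝕜] [NormedAddCommGroup E] [NormedSpace 𝕜 E]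
    (x : ℕ → E) (a : E) : Prop :=
  Tendsto (fun n => toWeakSpace 𝕜 E (x n)) atTop (𝓝 (toWeakSpace 𝕜 E a))

/-- A bounded operator is *completely continuous* if it takes weakly convergent sequences to
norm convergent sequences. -/
def IsCompletelyContinuousOperator {𝕜 E F : Type*} [RCLike 𝕜] [NormedAddCommGroup E]
    [NormedSpace 𝕜 E] [NormedAddCommGroup F] [NormedSpace 𝕜 F] (T : E →L[𝕜] F) : Prop :=
  ∀ x : ℕ → E, (∃ a : E, WeaklyConvergesTo 𝕜 x a) →
    ∃ b : F, Tendsto (fun n => T (x n)) atTop (𝓝 b)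

/-- `E` has the *Dunford–Pettis property*: every weakly compact operator from `E` into a Banach
space `G` is completely continuous. The targets `G` range over the universe `w`. -/
def HasDunfordPettisProperty (𝕜 : Type) (E : Type u) [RCLike 𝕜]
    [NormedAddCommGroup E] [NormedSpace 𝕜 E] : Prop :=
  ∀ (G : Type w) [NormedAddCommGroup G] [NormedSpace 𝕜 G] [CompleteSpace G] (T : E →L[𝕜] G),
    IsWeaklyCompactOperator T → IsCompletelyContinuousOperator T

/-- The sequence `x` is *weak Cauchy*: `φ (x n)` is a Cauchy sequence of scalars for every bounded
linear functional `φ`. -/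
def IsWeakCauchySeq (𝕜 : Type*) {E : Type*} [RCLike 𝕜] [NormedAddCommGroup E] [NormedSpace 𝕜 E]
    (x : ℕ → E) : Prop :=
  ∀ φ : StrongDual 𝕜 E, CauchySeq (fun n => φ (x n))

open scoped ZeroAtInfty

section Weak

variable {𝕜 : Type*} [RCLike 𝕜]
  {E : Type*} [NormedAddCommGroup E] [NormedSpace 𝕜 E]
  {F : Type*} [NormedAddCommGroup F] [NormedSpace 𝕜 F]

theorem tendsto_toWeakSpace_iff {ι : Type*} {l : Filter ι} {f : ι → F} {a : F} :
    Tendsto (fun i => toWeakSpace 𝕜 F (f i)) l (𝓝 (toWeakSpace 𝕜 F a)) ↔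
      ∀ φ : StrongDual 𝕜 F, Tendsto (fun i => φ (f i)) l (𝓝 (φ a)) := by
  refine WeakBilin.tendsto_iff_forall_eval_tendsto (topDualPairing 𝕜 F).flip ?_
  intro x y hxy
  rw [SeparatingDual.eq_iff_forall_dual_eq (R := 𝕜)]
  exact fun g => DFunLike.congr_fun hxy g

/-- Weak limits are unique. -/
theorem eq_of_forall_dual_tendsto {ι : Type*} {l : Filter ι} [l.NeBot] {f : ι → F} {a b : F}
    (ha : ∀ φ : StrongDual 𝕜 F, Tendsto (fun i => φ (f i)) l (𝓝 (φ a)))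
    (hb : ∀ φ : StrongDual 𝕜 F, Tendsto (fun i => φ (f i)) l (𝓝 (φ b))) : a = b :=
  (SeparatingDual.eq_iff_forall_dual_eq (R := 𝕜)).2 fun φ => tendsto_nhds_unique (ha φ) (hb φ)

/-- The norm is weakly lower semicontinuous. -/
theorem norm_le_of_forall_dual_tendsto {ι : Type*} {l : Filter ι} [l.NeBot] {f : ι → F} {a : F}
    {C : ℝ} (ha : ∀ φ : StrongDual 𝕜 F, Tendsto (fun i => φ (f i)) l (𝓝 (φ a)))
    (hC : ∀ i, ‖f i‖ ≤ C) : ‖a‖ ≤ C := by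
  have hC0 : 0 ≤ C := by
    obtain ⟨i⟩ : Nonempty ι := l.nonempty_of_neBot
    exact (norm_nonneg _).trans (hC i)
  refine NormedSpace.norm_le_dual_bound 𝕜 a hC0 fun φ => ?_
  refine le_of_tendsto (ha φ).norm (Eventually.of_forall fun i => ?_)
  calc ‖φ (f i)‖ ≤ ‖φ‖ * ‖f i‖ := φ.le_opNorm _
    _ ≤ ‖φ‖ * C := by gcongr; exact hC i
    _ = C * ‖φ‖ := mul_comm _ _

theorem isCompact_closure_range_of_forall_ultrafilter {ι X : Type*} [TopologicalSpace X]
    [T3Space X] {f : ι → X} (h : ∀ U : Ultrafilter ι, ∃ a, Tendsto f U (𝓝 a)) :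
    IsCompact (closure (Set.range f)) := by
  let _ : TopologicalSpace ι := ⊥
  have : DiscreteTopology ι := ⟨rfl⟩
  have hcont : Continuous ((isDenseInducing_pure (α := ι)).extend f) :=
    isDenseInducing_pure.continuous_extend fun U =>
      (h U).imp fun a ha => ha.mono_left (ultrafilter_comap_pure_nhds U)
  refine (isCompact_range hcont).closure_of_subset ?_
  rintro _ ⟨i, rfl⟩
  exact ⟨pure i, isDenseInducing_pure.extend_eq continuous_of_discreteTopology i⟩

/-- An operator is weakly compact if and only if it maps ultrafilters on the unit ball to weakly
convergent ones. -/
theorem isWeaklyCompactOperator_iff_forall_ultrafilter {T : E →L[𝕜] F} :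
    IsWeaklyCompactOperator T ↔ ∀ U : Ultrafilter (Metric.closedBall (0 : E) 1),
      ∃ b : F, ∀ φ : StrongDual 𝕜 F,
        Tendsto (fun y : Metric.closedBall (0 : E) 1 => φ (T y)) U (𝓝 (φ b)) := by
  constructor
  · intro hT U
    obtain ⟨b, -, hb⟩ := hT.ultrafilter_le_nhds
      (U.map fun y : Metric.closedBall (0 : E) 1 => toWeakSpace 𝕜 F (T y)) (by
        rw [le_principal_iff]
        exact Ultrafilter.mem_map.2 (Filter.univ_mem' fun y =>
          subset_closure ⟨T y, ⟨y, y.2, rfl⟩, rfl⟩))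
    exact ⟨(toWeakSpace 𝕜 F).symm b, tendsto_toWeakSpace_iff.1 (by simpa using! hb)⟩
  · intro h
    have : toWeakSpace 𝕜 F '' (T '' Metric.closedBall (0 : E) 1) =
        Set.range fun y : Metric.closedBall (0 : E) 1 => toWeakSpace 𝕜 F (T y) := by
      ext z; simp
    rw [IsWeaklyCompactOperator, this]
    refine isCompact_closure_range_of_forall_ultrafilter fun U => ?_
    obtain ⟨b, hb⟩ := h U
    exact ⟨_, tendsto_toWeakSpace_iff.2 hb⟩

theorem IsWeaklyCompactOperator.clm_comp {G : Type*} [NormedAddCommGroup G] [NormedSpace 𝕜 G]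
    {T : E →L[𝕜] F} (hT : IsWeaklyCompactOperator T) (S : F →L[𝕜] G) :
    IsWeaklyCompactOperator (S ∘L T) := by
  rw [isWeaklyCompactOperator_iff_forall_ultrafilter] at hT ⊢
  intro U
  obtain ⟨b, hb⟩ := hT U
  exact ⟨S b, fun φ => hb (φ ∘L S)⟩

theorem IsCompletelyContinuousOperator.tendsto_zero {T : E →L[𝕜] F}
    (hT : IsCompletelyContinuousOperator T) {x : ℕ → E}
    (hx : ∀ φ : StrongDual 𝕜 E, Tendsto (fun n => φ (x n)) atTop (𝓝 0)) :
    Tendsto (fun n => T (x n)) atTop (𝓝 0) := by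
  obtain ⟨b, hb⟩ := hT x ⟨0, tendsto_toWeakSpace_iff.2 fun φ => by simpa using hx φ⟩
  have : b = 0 := eq_of_forall_dual_tendsto (𝕜 := 𝕜) (fun φ => (φ.continuous.tendsto b).comp hb)
    fun φ => by simpa using hx (φ ∘L T)
  rwa [this] at hb

theorem cauchySeq_of_forall_tendsto_sub {G : Type*} [NormedAddCommGroup G] {f : ℕ → G}
    (h : ∀ p q : ℕ → ℕ, Tendsto p atTop atTop → Tendsto q atTop atTop →
      Tendsto (fun j => f (p j) - f (q j)) atTop (𝓝 0)) : CauchySeq f := by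
  rw [Metric.cauchySeq_iff]
  by_contra! hcon
  obtain ⟨ε, hε, hcon⟩ := hcon
  choose p hp q hq hpq using hcon
  have := h p q (tendsto_atTop_mono hp tendsto_id) (tendsto_atTop_mono hq tendsto_id)
  obtain ⟨N, hN⟩ := (Metric.tendsto_atTop.1 this) ε hε
  have h1 := hN N le_rfl
  have h2 := hpq N
  rw [dist_zero_right, ← dist_eq_norm] at h1
  exact absurd h1 (not_lt.2 h2)

theorem IsWeakCauchySeq.tendsto_sub {x : ℕ → E} (hx : IsWeakCauchySeq 𝕜 x) {p q : ℕ → ℕ}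
    (hp : Tendsto p atTop atTop) (hq : Tendsto q atTop atTop) (φ : StrongDual 𝕜 E) :
    Tendsto (fun j => φ (x (p j) - x (q j))) atTop (𝓝 0) := by
  obtain ⟨a, ha⟩ := cauchySeq_tendsto_of_complete (hx φ)
  simpa using (ha.comp hp).sub (ha.comp hq)

theorem IsCompletelyContinuousOperator.exists_tendsto [CompleteSpace F] {T : E →L[𝕜] F}
    (hT : IsCompletelyContinuousOperator T) {x : ℕ → E} (hx : IsWeakCauchySeq 𝕜 x) :
    ∃ b, Tendsto (fun n => T (x n)) atTop (𝓝 b) := by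
  refine cauchySeq_tendsto_of_complete (cauchySeq_of_forall_tendsto_sub fun p q hp hq => ?_)
  simpa using hT.tendsto_zero (hx.tendsto_sub hp hq)

end Weak

section DunfordPettis

theorem HasDunfordPettisProperty.exists_tendsto {𝕜 : Type} [RCLike 𝕜]
    {E : Type u} [NormedAddCommGroup E] [NormedSpace 𝕜 E]
    {G : Type v} [NormedAddCommGroup G] [NormedSpace 𝕜 G] [CompleteSpace G]
    (hE : HasDunfordPettisProperty.{max u v} 𝕜 E) {T : E →L[𝕜] G}
    (hT : IsWeaklyCompactOperator T) {x : ℕ → E} (hx : IsWeakCauchySeq 𝕜 x) :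
    ∃ b, Tendsto (fun n => T (x n)) atTop (𝓝 b) := by
  let e : ULift.{u} G ≃ₗᵢ[𝕜] G := LinearIsometryEquiv.ulift 𝕜 G
  let e' : G →L[𝕜] ULift.{u} G := (e.symm.toContinuousLinearEquiv : G →L[𝕜] ULift.{u} G)
  obtain ⟨b, hb⟩ := (hE (ULift.{u} G) (e' ∘L T) (hT.clm_comp e')).exists_tendsto hx
  exact ⟨e b, (e.continuous.tendsto b).comp hb⟩

end DunfordPettis

section NullSequences

variable {𝕜 : Type*} [RCLike 𝕜]
  {E : Type*} [NormedAddCommGroup E] [NormedSpace 𝕜 E]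
  {F : Type*} [NormedAddCommGroup F] [NormedSpace 𝕜 F]

namespace ZeroAtInftyContinuousMap

/-- A null sequence, as an element of `c₀(F)`. -/
def ofTendsto (f : ℕ → F) (hf : Tendsto f atTop (𝓝 0)) : C₀(ℕ, F) where
  toFun := f
  continuous_toFun := continuous_of_discreteTopology
  zero_at_infty' := by rwa [cocompact_eq_atTop]

@[simp]
theorem ofTendsto_apply (f : ℕ → F) (hf : Tendsto f atTop (𝓝 0)) (n : ℕ) :
    ofTendsto f hf n = f n := rfl

theorem tendsto_atTop_zero (u : C₀(ℕ, F)) : Tendsto u atTop (𝓝 0) := by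
  simpa [cocompact_eq_atTop] using u.zero_at_infty'

theorem norm_le_iff {u : C₀(ℕ, F)} {C : ℝ} (hC : 0 ≤ C) : ‖u‖ ≤ C ↔ ∀ n, ‖u n‖ ≤ C := by
  rw [← norm_toBCF_eq_norm, BoundedContinuousFunction.norm_le hC]
  rfl

theorem norm_apply_le (u : C₀(ℕ, F)) (n : ℕ) : ‖u n‖ ≤ ‖u‖ :=
  (norm_le_iff (norm_nonneg u)).1 le_rfl n

variable (𝕜 F) in
/-- The inclusion of the `n`-th coordinate into `c₀(F)`. -/
noncomputable def single (n : ℕ) : F →L[𝕜] C₀(ℕ, F) :=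
  LinearMap.mkContinuous
    { toFun := fun a => ofTendsto (Pi.single n a) (tendsto_const_nhds.congr' (by
        filter_upwards [eventually_gt_atTop n] with m hm
        rw [Pi.single_eq_of_ne hm.ne']))
      map_add' := fun a b => by ext m; simp [Pi.single_add]
      map_smul' := fun c a => by ext m; simp [Pi.single_smul] }
    1 fun a => (norm_le_iff (by positivity)).2 fun m => by
      by_cases h : m = n
      · subst h; simp
      · simp [Pi.single_eq_of_ne h]

theorem single_apply (n m : ℕ) (a : F) : single 𝕜 F n a m = if m = n then a else 0 := by
  simp [single, Pi.single_apply]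

theorem sum_apply (s : Finset ℕ) (u : ℕ → C₀(ℕ, F)) (m : ℕ) :
    (∑ n ∈ s, u n) m = ∑ n ∈ s, u n m := by
  induction s using Finset.induction_on with
  | empty => simp
  | insert n s hn ih => simp [Finset.sum_insert hn, ih]

theorem sum_single_apply (s : Finset ℕ) (f : ℕ → F) (m : ℕ) :
    (∑ n ∈ s, single 𝕜 F n (f n)) m = if m ∈ s then f m else 0 := by
  simp [sum_apply, single_apply]

theorem hasSum_single (u : C₀(ℕ, F)) : HasSum (fun n => single 𝕜 F n (u n)) u := by
  rw [HasSum, SummationFilter.unconditional_filter, Metric.tendsto_atTop]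
  intro ε hε
  obtain ⟨N, hN⟩ := Metric.tendsto_atTop.1 u.tendsto_atTop_zero (ε / 2) (half_pos hε)
  refine ⟨Finset.range N, fun s hs => ?_⟩
  rw [dist_eq_norm]
  refine ((norm_le_iff (half_pos hε).le).2 fun m => ?_).trans_lt (half_lt_self hε)
  rw [sub_apply, sum_single_apply]
  split_ifs with hm
  · simpa using (half_pos hε).le
  · have hmN : N ≤ m := by
      by_contra! hlt
      exact hm (hs (Finset.mem_range.2 hlt))
    simpa using (hN m hmN).le

end ZeroAtInftyContinuousMap

open ZeroAtInftyContinuousMap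

theorem ContinuousLinearMap.exists_norm_le_one_apply_eq_ofReal (φ : StrongDual 𝕜 F) :
    ∃ a : F, ‖a‖ ≤ 1 ∧ ∃ c : ℝ, φ a = (c : 𝕜) ∧ ‖φ‖ ≤ 2 * c := by
  by_cases h0 : ‖φ‖ = 0
  · exact ⟨0, by simp, 0, by simp, by simp [h0]⟩
  have hpos : 0 < ‖φ‖ := lt_of_le_of_ne (norm_nonneg _) (Ne.symm h0)
  obtain ⟨a, ha, hφ⟩ := φ.exists_lt_apply_of_lt_opNorm (half_lt_self hpos)
  have hne : ‖φ a‖ ≠ 0 := (lt_trans (half_pos hpos) hφ).ne'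
  refine ⟨((starRingEnd 𝕜 (φ a)) / (‖φ a‖ : 𝕜)) • a, ?_, ‖φ a‖, ?_, by linarith⟩
  · rw [norm_smul, norm_div, RCLike.norm_conj, RCLike.norm_ofReal, abs_norm, div_self hne, one_mul]
    exact ha.le
  · have hne' : (‖φ a‖ : 𝕜) ≠ 0 := by exact_mod_cast hne
    rw [map_smul, smul_eq_mul, div_mul_eq_mul_div, RCLike.conj_mul, sq, mul_div_assoc,
      div_self hne', mul_one]

theorem summable_norm_comp_single (φ : StrongDual 𝕜 C₀(ℕ, F)) :
    Summable fun n => ‖φ ∘L single 𝕜 F n‖ := by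
  choose a ha c hc hφ using fun n =>
    (φ ∘L single 𝕜 F n).exists_norm_le_one_apply_eq_ofReal
  refine summable_of_sum_le (c := 2 * ‖φ‖) (fun n => norm_nonneg _) fun s => ?_
  have hle : ‖∑ n ∈ s, single 𝕜 F n (a n)‖ ≤ 1 := by
    refine (norm_le_iff zero_le_one).2 fun m => ?_
    rw [sum_single_apply]
    split_ifs
    · exact ha m
    · simp
  have hval : φ (∑ n ∈ s, single 𝕜 F n (a n)) = ((∑ n ∈ s, c n : ℝ) : 𝕜) := by
    rw [map_sum, RCLike.ofReal_sum]
    exact Finset.sum_congr rfl fun n _ => hc n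
  calc ∑ n ∈ s, ‖φ ∘L single 𝕜 F n‖ ≤ ∑ n ∈ s, 2 * c n := Finset.sum_le_sum fun n _ => hφ n
    _ = 2 * ∑ n ∈ s, c n := (Finset.mul_sum _ _ _).symm
    _ ≤ 2 * ‖φ (∑ n ∈ s, single 𝕜 F n (a n))‖ := by
      rw [hval, RCLike.norm_ofReal]; gcongr; exact le_abs_self _
    _ ≤ 2 * ‖φ‖ := by
      gcongr; exact φ.le_of_opNorm_le_of_le le_rfl hle |>.trans_eq (mul_one _)

/-- In `c₀(F)`, bounded coordinatewise weak convergence implies weak convergence. -/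
theorem tendsto_dual_of_forall_coord {ι : Type*} {l : Filter ι} {u : ι → C₀(ℕ, F)}
    {g : C₀(ℕ, F)} {C : ℝ} (hC : ∀ i, ‖u i‖ ≤ C)
    (h : ∀ n, ∀ φ : StrongDual 𝕜 F, Tendsto (fun i => φ (u i n)) l (𝓝 (φ (g n))))
    (φ : StrongDual 𝕜 C₀(ℕ, F)) : Tendsto (fun i => φ (u i)) l (𝓝 (φ g)) := by
  have key : ∀ v : C₀(ℕ, F), φ v = ∑' n, (φ ∘L single 𝕜 F n) (v n) := fun v =>
    (φ.hasSum (hasSum_single (𝕜 := 𝕜) v)).tsum_eq.symm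
  simp only [key]
  refine tendsto_tsum_of_dominated_convergence ((summable_norm_comp_single φ).mul_right C)
    (fun n => h n _) (Eventually.of_forall fun i n => ?_)
  refine ContinuousLinearMap.le_opNorm_of_le _ ((norm_apply_le _ n).trans (hC i))

/-- A pointwise null sequence of operators, bounded in norm, as an operator into `c₀(F)`. -/
noncomputable def ContinuousLinearMap.toNullSequences (D : ℕ → E →L[𝕜] F) (C : ℝ) (hC : ∀ n, ‖D n‖ ≤ C)
    (hD : ∀ y, Tendsto (fun n => D n y) atTop (𝓝 0)) : E →L[𝕜] C₀(ℕ, F) :=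
  LinearMap.mkContinuous
    { toFun := fun y => ofTendsto (fun n => D n y) (hD y)
      map_add' := fun a b => by ext m; simp
      map_smul' := fun c a => by ext m; simp }
    C fun y => by
      have hC0 : 0 ≤ C := (norm_nonneg _).trans (hC 0)
      exact (norm_le_iff (by positivity)).2 fun n => (D n).le_of_opNorm_le (hC n) y

@[simp]
theorem ContinuousLinearMap.toNullSequences_apply (D : ℕ → E →L[𝕜] F) (C : ℝ)
    (hC : ∀ n, ‖D n‖ ≤ C) (hD : ∀ y, Tendsto (fun n => D n y) atTop (𝓝 0)) (y : E) (n : ℕ) :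
    ContinuousLinearMap.toNullSequences D C hC hD y n = D n y := rfl

theorem ContinuousLinearMap.isWeaklyCompactOperator_toNullSequences (D : ℕ → E →L[𝕜] F) (C : ℝ)
    (hC : ∀ n, ‖D n‖ ≤ C) (hD : ∀ y, Tendsto (fun n => D n y) atTop (𝓝 0))
    (hU : ∀ U : Ultrafilter (Metric.closedBall (0 : E) 1), ∃ b : ℕ → F,
      Tendsto b atTop (𝓝 0) ∧
      ∀ n, ∀ φ : StrongDual 𝕜 F,
        Tendsto (fun y : Metric.closedBall (0 : E) 1 => φ (D n y)) U (𝓝 (φ (b n)))) :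
    IsWeaklyCompactOperator (ContinuousLinearMap.toNullSequences D C hC hD) := by
  rw [isWeaklyCompactOperator_iff_forall_ultrafilter]
  intro U
  obtain ⟨b, hb0, hb⟩ := hU U
  refine ⟨ofTendsto b hb0, fun φ => ?_⟩
  refine tendsto_dual_of_forall_coord
    (C := ‖ContinuousLinearMap.toNullSequences D C hC hD‖) (fun y => ?_) hb φ
  exact ContinuousLinearMap.unit_le_opNorm _ _ (mem_closedBall_zero_iff.1 y.2)

end NullSequences

section Multilinear

open ZeroAtInftyContinuousMap

theorem HasDunfordPettisProperty.tendsto_diagonal_of_null {𝕜 : Type} [RCLike 𝕜]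
    {E : Type u} [NormedAddCommGroup E] [NormedSpace 𝕜 E] [CompleteSpace E]
    {F : Type v} [NormedAddCommGroup F] [NormedSpace 𝕜 F] [CompleteSpace F]
    (hE : HasDunfordPettisProperty.{max u v} 𝕜 E) {D : ℕ → E →L[𝕜] F}
    (hD : ∀ y, Tendsto (fun n => D n y) atTop (𝓝 0))
    (hU : ∀ U : Ultrafilter (Metric.closedBall (0 : E) 1), ∃ b : ℕ → F,
      Tendsto b atTop (𝓝 0) ∧
      ∀ n, ∀ φ : StrongDual 𝕜 F,
        Tendsto (fun y : Metric.closedBall (0 : E) 1 => φ (D n y)) U (𝓝 (φ (b n))))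
    {y : ℕ → E} (hy : IsWeakCauchySeq 𝕜 y) (r : ℕ → ℕ) :
    Tendsto (fun n => D n (y (r n))) atTop (𝓝 0) := by
  obtain ⟨C, hC⟩ := banach_steinhaus (g := D) fun x => by
    obtain ⟨M, hM⟩ := (hD x).norm.bddAbove_range
    exact ⟨M, fun n => hM ⟨n, rfl⟩⟩
  obtain ⟨g, hg⟩ := hE.exists_tendsto
    (ContinuousLinearMap.isWeaklyCompactOperator_toNullSequences D C hC hD hU) hy
  rw [Metric.tendsto_atTop] at hg ⊢
  intro ε hε
  obtain ⟨N, hN⟩ := hg (ε / 2) (half_pos hε)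
  have hfin : ∀ᶠ n in atTop, ∀ i ∈ Finset.range N, ‖D n (y i)‖ < ε := by
    rw [Filter.eventually_all_finset]
    intro i _
    simpa using (hD (y i)).norm.eventually_lt_const (by simpa using hε)
  have hgn : ∀ᶠ n in atTop, ‖g n‖ < ε / 2 :=
    g.tendsto_atTop_zero.norm.eventually_lt_const (by simpa using half_pos hε)
  rw [← eventually_atTop (p := fun n => dist (D n (y (r n))) 0 < ε)]
  filter_upwards [hfin, hgn] with n h1 h2
  rw [dist_zero_right]
  rcases lt_or_ge (r n) N with h | h
  · exact h1 _ (Finset.mem_range.2 h)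
  · have h3 := hN _ h
    rw [dist_eq_norm] at h3
    have h4 := (norm_apply_le
      (ContinuousLinearMap.toNullSequences D C hC hD (y (r n)) - g) n).trans_lt h3
    rw [ZeroAtInftyContinuousMap.sub_apply,
      ContinuousLinearMap.toNullSequences_apply] at h4
    calc ‖D n (y (r n))‖ = ‖(D n (y (r n)) - g n) + g n‖ := by rw [sub_add_cancel]
      _ ≤ ‖D n (y (r n)) - g n‖ + ‖g n‖ := norm_add_le _ _
      _ < ε := by linarith

theorem HasDunfordPettisProperty.exists_tendsto_diagonal {𝕜 : Type} [RCLike 𝕜]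
    {E : Type u} [NormedAddCommGroup E] [NormedSpace 𝕜 E] [CompleteSpace E]
    {F : Type v} [NormedAddCommGroup F] [NormedSpace 𝕜 F] [CompleteSpace F]
    (hE : HasDunfordPettisProperty.{max u v} 𝕜 E)
    {T : ℕ → E →L[𝕜] F} (hwc : ∀ n, IsWeaklyCompactOperator (T n))
    (hT : ∀ y, ∃ a, Tendsto (fun n => T n y) atTop (𝓝 a))
    (hU : ∀ U : Ultrafilter (Metric.closedBall (0 : E) 1), ∃ (b : ℕ → F) (b' : F),
      Tendsto b atTop (𝓝 b') ∧
      ∀ n, ∀ φ : StrongDual 𝕜 F,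
        Tendsto (fun y : Metric.closedBall (0 : E) 1 => φ (T n y)) U (𝓝 (φ (b n))))
    {y : ℕ → E} (hy : IsWeakCauchySeq 𝕜 y) :
    ∃ a, Tendsto (fun n => T n (y n)) atTop (𝓝 a) := by
  have hdiff : ∀ p q r : ℕ → ℕ, Tendsto p atTop atTop → Tendsto q atTop atTop →
      Tendsto (fun j => T (p j) (y (r j)) - T (q j) (y (r j))) atTop (𝓝 0) := by
    intro p q r hp hq
    refine hE.tendsto_diagonal_of_null (D := fun j => T (p j) - T (q j)) (fun z => ?_)
      (fun U => ?_) hy r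
    · obtain ⟨a, ha⟩ := hT z
      simpa using (ha.comp hp).sub (ha.comp hq)
    · obtain ⟨b, b', hb, hbU⟩ := hU U
      refine ⟨fun j => b (p j) - b (q j), by simpa using (hb.comp hp).sub (hb.comp hq), ?_⟩
      intro n φ
      simpa using (hbU (p n) φ).sub (hbU (q n) φ)
  have hunif : ∀ ε > 0, ∃ N, ∀ n ≥ N, ∀ i, ‖T n (y i) - T N (y i)‖ < ε := by
    by_contra! hcon
    obtain ⟨ε, hε, hcon⟩ := hcon
    choose p hp r hr using hcon
    have := (hdiff p id r (tendsto_atTop_mono hp tendsto_id) tendsto_id).norm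
    rw [norm_zero] at this
    obtain ⟨N, hN⟩ := (this.eventually_lt_const hε).exists
    exact absurd hN (not_lt.2 (hr N))
  refine cauchySeq_tendsto_of_complete ?_
  rw [Metric.cauchySeq_iff']
  intro ε hε
  obtain ⟨N, hN⟩ := hunif (ε / 4) (by positivity)
  obtain ⟨b, hb⟩ := hE.exists_tendsto (hwc N) hy
  obtain ⟨M, hM⟩ := Metric.cauchySeq_iff.1 hb.cauchySeq (ε / 4) (by positivity)
  refine ⟨max N M, fun n hn => ?_⟩
  have h1 := hN n ((le_max_left N M).trans hn) n
  have h2 := hN (max N M) (le_max_left N M) (max N M)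
  have h3 := hM n ((le_max_right N M).trans hn) (max N M) (le_max_right N M)
  rw [← dist_eq_norm] at h1 h2
  rw [dist_comm] at h2
  have h4 := dist_triangle4 (T n (y n)) (T N (y n)) (T N (y (max N M)))
    (T (max N M) (y (max N M)))
  linarith

/-- The weak limit of `A (y, ·)` along an ultrafilter of points `y` of the unit ball is again a
continuous multilinear map. -/
theorem ContinuousMultilinearMap.exists_weakLimit {𝕜 : Type*} [RCLike 𝕜]
    {E : Type*} [NormedAddCommGroup E] [NormedSpace 𝕜 E]
    {F : Type*} [NormedAddCommGroup F] [NormedSpace 𝕜 F]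
    (hEF : ∀ T : E →L[𝕜] F, IsWeaklyCompactOperator T) {k : ℕ}
    (L : E →L[𝕜] ContinuousMultilinearMap 𝕜 (fun _ : Fin k => E) F)
    (U : Ultrafilter (Metric.closedBall (0 : E) 1)) :
    ∃ B : ContinuousMultilinearMap 𝕜 (fun _ : Fin k => E) F,
      ∀ v, ∀ φ : StrongDual 𝕜 F,
        Tendsto (fun y : Metric.closedBall (0 : E) 1 => φ (L y v)) U (𝓝 (φ (B v))) := by
  have hlim : ∀ v : Fin k → E, ∃ b : F, ∀ φ : StrongDual 𝕜 F,
      Tendsto (fun y : Metric.closedBall (0 : E) 1 => φ (L y v)) U (𝓝 (φ b)) := fun v =>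
    isWeaklyCompactOperator_iff_forall_ultrafilter.1
      (hEF (ContinuousMultilinearMap.apply 𝕜 _ _ v ∘L L)) U
  choose b hb using hlim
  refine ⟨MultilinearMap.mkContinuous
    { toFun := b
      map_update_add' := fun v i c d => ?_
      map_update_smul' := fun v i c d => ?_ } ‖L‖ fun v => ?_, hb⟩
  · refine eq_of_forall_dual_tendsto (𝕜 := 𝕜) (hb _) fun φ => ?_
    simpa using (hb (Function.update v i c) φ).add (hb (Function.update v i d) φ)
  · refine eq_of_forall_dual_tendsto (𝕜 := 𝕜) (hb _) fun φ => ?_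
    simpa using (hb (Function.update v i d) φ).const_mul c
  · refine norm_le_of_forall_dual_tendsto (hb v) fun y => ?_
    exact (L y).le_of_opNorm_le (L.unit_le_opNorm _ (mem_closedBall_zero_iff.1 y.2)) v

end Multilinear

theorem mainTheorem3 {𝕜 : Type} [RCLike 𝕜]
    {E : Type u} [NormedAddCommGroup E] [NormedSpace 𝕜 E] [CompleteSpace E]
    {F : Type v} [NormedAddCommGroup F] [NormedSpace 𝕜 F] [CompleteSpace F]
    (hE : HasDunfordPettisProperty.{max u v} 𝕜 E)
    (hEF : ∀ T : E →L[𝕜] F, IsWeaklyCompactOperator T)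
    (k : ℕ) (A : ContinuousMultilinearMap 𝕜 (fun _ : Fin k => E) F)
    (x : Fin k → ℕ → E) (hx : ∀ i, IsWeakCauchySeq 𝕜 (x i)) :
    ∃ y : F, Tendsto (fun n => A (fun i => x i n)) atTop (𝓝 y) := by
  induction k with
  | zero =>
    refine ⟨A 0, tendsto_const_nhds.congr fun n => ?_⟩
    rw [Subsingleton.elim (fun i => x i n) 0]
  | succ k ih =>
    have ih' := fun B => ih B (fun i => x i.succ) (fun i => hx i.succ)
    obtain ⟨a, ha⟩ := hE.exists_tendsto_diagonal
      (T := fun n => ContinuousMultilinearMap.apply 𝕜 _ _ (fun i : Fin k => x i.succ n) ∘L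
        A.curryLeft)
      (fun n => hEF _) (fun y => ih' (A.curryLeft y))
      (fun U => by
        obtain ⟨B, hB⟩ := ContinuousMultilinearMap.exists_weakLimit hEF A.curryLeft U
        obtain ⟨b', hb'⟩ := ih' B
        exact ⟨_, b', hb', fun n φ => hB _ φ⟩)
      (hx 0)
    refine ⟨a, ha.congr fun n => ?_⟩
    exact congrArg A (Fin.cons_self_tail fun i => x i n)
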